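/- A simplicial complex is a set $L$ of pairwise disjoint open simplices (each spanned by finitely many affinely independent vertices) in a real vector space, possibly infinite-dimensional, such that every face of a simplex in $L$ is again in $L$; it need not be locally finite, and it is finite-dimensional if the dimensions of its simplices are bounded. A subcomplex of $L$ is a subset of $L$ that is itself a simplicial complex. The union $|L|$ of the simplices of $L$ carries the weak topology, in which a set is closed if and only if its intersection with each closed simplex of $L$ is closed in the standard topology of that simplex. For a simplex $\sigma$ of $L$, $\mathrm{link}_L(\sigma)$ is the subcomplex of all simplices $\tau$ of $L$ such that $\tau$ and $\sigma$ have no vertex in common and are both faces of some simplex of $L$. A complex is called contractible if its underlying space is contractible (in particular, nonempty). Let $L$ be a finite-dimensional simplicial complex and let $L_0$ be a subcomplex of $L$. Suppose that for every simplex $\sigma$ of $L_0$ the complex $\mathrm{link}_L(\sigma)$ is contractible. Then the inclusion map $|L|-|L_0|\hookrightarrow|L|$ is a homotopy equivalence, where $|L|-|L_0|$ has the subspace topology from $|L|$. -/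

import Mathlib

namespace Geometry.SimplicialComplex

variable {E : Type*} [AddCommGroup E] [Module ℝ E]

/-- The complex `K` is finite-dimensional: the dimensions of its simplices are bounded
(a simplex with vertex set `s` has dimension `s.card - 1`). -/
def IsFiniteDimensional (K : SimplicialComplex ℝ E) : Prop :=
  ∃ n : ℕ, ∀ s ∈ K.faces, s.card ≤ n + 1

/-- The link of `σ` in `K`: the subcomplex of the simplices of `K` which have no vertex in common
with `σ` and which together with `σ` are faces of some simplex of `K`. -/
def link (K : SimplicialComplex ℝ E) (σ : Finset E) : SimplicialComplex ℝ E where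
  faces := {τ | τ ∈ K.faces ∧ Disjoint τ σ ∧ ∃ ρ ∈ K.faces, σ ⊆ ρ ∧ τ ⊆ ρ}
  isRelLowerSet_faces := by
    rintro τ ⟨hτ, hd, ρ, hρ, hσρ, hτρ⟩
    refine ⟨K.nonempty_of_mem_faces hτ, fun τ' hle hne => ?_⟩
    exact ⟨K.down_closed hτ hle hne, hd.mono_left hle, ρ, hρ, hσρ, hle.trans hτρ⟩
  indep := fun hs => K.indep hs.1
  inter_subset_convexHull := fun hs ht => K.inter_subset_convexHull hs.1 ht.1

/-- The underlying space `|K|` of `K`, the union of the simplices of `K`, as a type of its own. It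
carries the weak topology below, not a subspace topology from the ambient vector space. -/
def Polyhedron (K : SimplicialComplex ℝ E) : Type _ :=
  {x : E // x ∈ K.space}

/-- A point of `|K|`, as a point of the ambient vector space. -/
def Polyhedron.val {K : SimplicialComplex ℝ E} (x : K.Polyhedron) : E :=
  Subtype.val x

theorem sum_smul_mem_space (K : SimplicialComplex ℝ E) {s : Finset E} (hs : s ∈ K.faces)
    (w : stdSimplex ℝ s) : ∑ v : s, w.1 v • (v : E) ∈ K.space :=
  convexHull_subset_space hs <|
    (convex_convexHull ℝ (s : Set E)).sum_mem (fun v _ => w.2.1 v) w.2.2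
      (fun v _ => subset_convexHull ℝ _ v.2)

/-- The parametrization by barycentric coordinates of the closed simplex of `K` with vertex
set `s`. -/
noncomputable def simplexMap (K : SimplicialComplex ℝ E) (s : K.faces)
    (w : stdSimplex ℝ (s : Finset E)) : K.Polyhedron :=
  ⟨∑ v : (s : Finset E), w.1 v • (v : E), K.sum_smul_mem_space s.2 w⟩

/-- The weak topology of `|K|`: a set is open (closed) if and only if its intersection with each
closed simplex is open (closed) in the standard topology of that simplex, that is, the topology
for which the barycentric coordinates are a homeomorphism onto a standard simplex. -/
noncomputable instance (K : SimplicialComplex ℝ E) : TopologicalSpace K.Polyhedron :=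
  ⨆ s : K.faces, TopologicalSpace.coinduced (K.simplexMap s) inferInstance

end Geometry.SimplicialComplex

/-- The continuous map `f` is a homotopy equivalence. -/
def IsHomotopyEquivalence {X Y : Type*} [TopologicalSpace X] [TopologicalSpace Y]
    (f : C(X, Y)) : Prop :=
  ∃ g : C(Y, X), (g.comp f).Homotopic (ContinuousMap.id X) ∧
    (f.comp g).Homotopic (ContinuousMap.id Y)

/-! The simplices of `L₀` are removed one dimension at a time. Passing from the complement of those
with at most `n` vertices to the complement of those with at most `n + 1` deletes the open simplices
`σ` with exactly `n + 1` vertices. Around each lies a cone neighbourhood of points `(1 - t) a + t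
b`, with `a` in `σ`, `b` in the link, and `t` at most a radius that vanishes on the boundary of `σ`.
Neighbourhoods of distinct `σ` meet only where both radii are zero
(`coneRadius_eq_zero_of_conePoint_eq`).

A contraction of the link pushes the neighbourhood off `σ`: the link is contracted, less and less
towards the outer edge of the cone, and then the cone coordinate grows to its maximum. At the tip of
the cone `b` is undetermined, but the tip moves only once the contraction there is complete, so the
push is well defined (`push_congr`). All pushes together form one homotopy of the whole space
(`continuous_pushMap`). It preserves both complements and carries the larger into the smaller
(`isHomotopyEquivalence_skeletonCompl_succ`). By finite-dimensionality, finitely many such steps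
suffice.

The argument runs on functions of barycentric coordinates; `realizationHomeomorph` transfers it to
the polyhedron. -/

/-! ### Closed simplices in barycentric coordinates -/

/-- The functions on `V` which are barycentric coordinates of a point of the closed simplex with
vertex set `s`. -/
def coordSimplex {V : Type*} (s : Finset V) : Set (V → ℝ) :=
  {w | (∀ v, 0 ≤ w v) ∧ (∀ v ∉ s, w v = 0) ∧ ∑ v ∈ s, w v = 1}

section coordSimplex

variable {V : Type*} {s t : Finset V} {w : V → ℝ}

theorem coordSimplex_mono (h : s ⊆ t) : coordSimplex s ⊆ coordSimplex t := by
  rintro w ⟨h0, h1, h2⟩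
  refine ⟨h0, fun v hv => h1 v fun hs => hv (h hs), ?_⟩
  rw [← h2]
  exact (Finset.sum_subset h fun v _ hv => h1 v hv).symm

theorem le_one_of_mem_coordSimplex (h : w ∈ coordSimplex s) (v : V) : w v ≤ 1 := by
  by_cases hv : v ∈ s
  · rw [← h.2.2]
    exact Finset.single_le_sum (fun i _ => h.1 i) hv
  · rw [h.2.1 v hv]
    exact zero_le_one

theorem isClosed_coordSimplex (s : Finset V) : IsClosed (coordSimplex s) := by
  have : coordSimplex s = (⋂ v, {w : V → ℝ | 0 ≤ w v}) ∩
      ((⋂ v ∈ ((s : Set V)ᶜ), {w : V → ℝ | w v = 0}) ∩ {w : V → ℝ | ∑ v ∈ s, w v = 1}) := by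
    ext w
    simp [coordSimplex]
  rw [this]
  refine (isClosed_iInter fun v => isClosed_le continuous_const (continuous_apply v)).inter
    ((isClosed_biInter fun v _ => isClosed_eq (continuous_apply v) continuous_const).inter
      (isClosed_eq (by fun_prop) continuous_const))

theorem isCompact_coordSimplex (s : Finset V) : IsCompact (coordSimplex s) :=
  (isCompact_univ_pi fun _ : V => isCompact_Icc (a := (0 : ℝ)) (b := 1)).of_isClosed_subset
    (isClosed_coordSimplex s) fun _ hw v _ => ⟨hw.1 v, le_one_of_mem_coordSimplex hw v⟩

instance (s : Finset V) : CompactSpace (coordSimplex s) :=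
  isCompact_iff_compactSpace.1 (isCompact_coordSimplex s)

theorem subset_of_mem_coordSimplex (ht : w ∈ coordSimplex t) (hpos : ∀ v ∈ s, 0 < w v) :
    s ⊆ t := by
  intro v hv
  by_contra h
  exact (hpos v hv).ne' (ht.2.1 v h)

theorem nonempty_of_mem_coordSimplex (h : w ∈ coordSimplex s) : s.Nonempty := by
  rw [Finset.nonempty_iff_ne_empty]
  rintro rfl
  simpa using h.2.2

/-- The sum of all coordinates is one, also when summed over more than the vertices. -/
theorem sum_add_sum_sdiff_eq_one [DecidableEq V] (h : w ∈ coordSimplex t) :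
    ∑ v ∈ s, w v + ∑ v ∈ t \ s, w v = 1 := by
  have h1 := (coordSimplex_mono (Finset.subset_union_right : t ⊆ s ∪ t) h).2.2
  rw [← h1, ← Finset.union_sdiff_self_eq_union, Finset.sum_union Finset.disjoint_sdiff]

end coordSimplex

/-! ### Weak topology and the join of a simplex with its link -/

/-- The geometric realization of the family `F` of simplices: the functions on vertices which are
barycentric coordinates of a point of one of the simplices. -/
def Realization {V : Type*} (F : Set (Finset V)) : Type _ :=
  {w : V → ℝ // ∃ s ∈ F, w ∈ coordSimplex s}

namespace Realization

variable {V : Type*} {F : Set (Finset V)}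

/-- The inclusion of a closed simplex. -/
def incl {s : Finset V} (hs : s ∈ F) (w : coordSimplex s) : Realization F :=
  ⟨w.1, s, hs, w.2⟩

/-- The weak topology. -/
instance (F : Set (Finset V)) : TopologicalSpace (Realization F) :=
  ⨆ s : F, TopologicalSpace.coinduced (incl s.2) inferInstance

theorem continuous_incl {s : Finset V} (hs : s ∈ F) : Continuous (incl hs) :=
  continuous_iff_coinduced_le.2 <|
    le_iSup (fun s : F => TopologicalSpace.coinduced (incl s.2) inferInstance) ⟨s, hs⟩

theorem continuous_of_simplices {Y : Type*} [TopologicalSpace Y] {f : Realization F → Y}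
    (h : ∀ s (hs : s ∈ F), Continuous fun w : coordSimplex s => f (incl hs w)) :
    Continuous f := by
  rw [continuous_iff_coinduced_le]
  change TopologicalSpace.coinduced f (⨆ s : F, _) ≤ _
  rw [coinduced_iSup]
  refine iSup_le fun s => ?_
  rw [coinduced_compose]
  exact continuous_iff_coinduced_le.1 (h s.1 s.2)

/-- The weak topology is compatible with products by a locally compact factor: the curried map into
`C(T, Y)` can be checked on simplices, and local compactness of `T` allows uncurrying. With `T` the
interval, this is how homotopies are tested. -/
theorem continuous_prod_of_simplices {T Y : Type*} [TopologicalSpace T] [LocallyCompactSpace T]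
    [TopologicalSpace Y] {f : Realization F × T → Y}
    (h : ∀ s (hs : s ∈ F), Continuous fun p : coordSimplex s × T => f (incl hs p.1, p.2)) :
    Continuous f := by
  have hf : ∀ x, Continuous fun t => f (x, t) := by
    rintro ⟨w, s, hs, hw⟩
    exact (h s hs).comp (f := fun t => (⟨w, hw⟩, t)) (by fun_prop)
  have hc : Continuous fun x => (⟨fun t => f (x, t), hf x⟩ : C(T, Y)) :=
    continuous_of_simplices fun s hs => ContinuousMap.continuous_of_continuous_uncurry _ (h s hs)
  exact ContinuousMap.continuous_uncurry_of_continuous ⟨_, hc⟩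

/-- The simplices of the link of `σ`. -/
def linkFaces (F : Set (Finset V)) (σ : Finset V) : Set (Finset V) :=
  {τ | τ ∈ F ∧ Disjoint τ σ ∧ ∃ ρ ∈ F, σ ⊆ ρ ∧ τ ⊆ ρ}

theorem coord_eq_zero_of_mem {σ : Finset V} (b : Realization (linkFaces F σ)) {v : V}
    (hv : v ∈ σ) : b.1 v = 0 := by
  obtain ⟨τ, hτ, hb⟩ := b.2
  exact hb.2.1 v (Finset.disjoint_right.1 hτ.2.1 hv)

theorem join_mem_coordSimplex [DecidableEq V] {σ τ : Finset V} {a b : V → ℝ}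
    (ha : a ∈ coordSimplex σ) (hb : b ∈ coordSimplex τ) (t : unitInterval) :
    (fun v => (1 - (t : ℝ)) * a v + t * b v) ∈ coordSimplex (σ ∪ τ) := by
  have ha' := coordSimplex_mono (Finset.subset_union_left : σ ⊆ σ ∪ τ) ha
  have hb' := coordSimplex_mono (Finset.subset_union_right : τ ⊆ σ ∪ τ) hb
  have h0 := t.2.1
  have h1 := t.2.2
  refine ⟨fun v => ?_, fun v hv => ?_, ?_⟩
  · have := ha.1 v
    have := hb.1 v
    have : 0 ≤ 1 - (t : ℝ) := by linarith
    positivity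
  · simp [ha'.2.1 v hv, hb'.2.1 v hv]
  · rw [Finset.sum_add_distrib, ← Finset.mul_sum, ← Finset.mul_sum, ha'.2.2, hb'.2.2]
    ring

theorem union_mem_of_mem_linkFaces [DecidableEq V] (hF : IsRelLowerSet F Finset.Nonempty)
    {σ τ : Finset V} (hτ : τ ∈ linkFaces F σ) : σ ∪ τ ∈ F := by
  obtain ⟨hτF, -, ρ, hρ, hσρ, hτρ⟩ := hτ
  exact (hF hρ).2 (Finset.union_subset hσρ hτρ)
    ((hF hτF).1.mono Finset.subset_union_right)

/-- The point `(1 - t) a + t b` of the join of the simplex `σ` and its link. -/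
def join (hF : IsRelLowerSet F Finset.Nonempty) {σ : Finset V} (a : coordSimplex σ)
    (b : Realization (linkFaces F σ)) (t : unitInterval) : Realization F :=
  ⟨fun v => (1 - (t : ℝ)) * a.1 v + t * b.1 v, by
    classical
    obtain ⟨τ, hτ, hb⟩ := b.2
    exact ⟨σ ∪ τ, union_mem_of_mem_linkFaces hF hτ, join_mem_coordSimplex a.2 hb t⟩⟩

theorem continuous_join (hF : IsRelLowerSet F Finset.Nonempty) (σ : Finset V) :
    Continuous fun p : Realization (linkFaces F σ) × (coordSimplex σ × unitInterval) =>
      join hF p.2.1 p.1 p.2.2 := by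
  classical
  refine continuous_prod_of_simplices fun τ hτ => ?_
  have : Continuous fun p : coordSimplex τ × (coordSimplex σ × unitInterval) =>
      (⟨_, join_mem_coordSimplex p.2.1.2 p.1.2 p.2.2⟩ : coordSimplex (σ ∪ τ)) := by
    refine Continuous.subtype_mk (continuous_pi fun v => ?_) _
    have h1 : Continuous fun p : coordSimplex τ × (coordSimplex σ × unitInterval) => p.1.1 v :=
      (continuous_apply v).comp (continuous_subtype_val.comp continuous_fst)
    have h2 : Continuous fun p : coordSimplex τ × (coordSimplex σ × unitInterval) => p.2.1.1 v :=
      (continuous_apply v).comp (continuous_subtype_val.comp (continuous_fst.comp continuous_snd))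
    fun_prop
  exact (continuous_incl (union_mem_of_mem_linkFaces hF hτ)).comp this

variable {hF : IsRelLowerSet F Finset.Nonempty} {σ : Finset V} (a : coordSimplex σ)
    (b : Realization (linkFaces F σ)) (t : unitInterval)

theorem join_apply_of_mem {v : V} (hv : v ∈ σ) :
    (join hF a b t).1 v = (1 - (t : ℝ)) * a.1 v := by
  simp [join, coord_eq_zero_of_mem b hv]

theorem join_apply_of_notMem {v : V} (hv : v ∉ σ) :
    (join hF a b t).1 v = t * b.1 v := by
  simp [join, a.2.2.1 v hv]

theorem sum_join : ∑ v ∈ σ, (join hF a b t).1 v = 1 - (t : ℝ) := by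
  rw [Finset.sum_congr rfl fun v hv => join_apply_of_mem a b t hv, ← Finset.mul_sum, a.2.2.2,
    mul_one]

theorem join_zero : (join hF a b 0).1 = a.1 := by
  ext v
  simp [join]

theorem coord_le_one (x : Realization F) (v : V) : x.1 v ≤ 1 := by
  obtain ⟨s, -, h⟩ := x.2
  exact le_one_of_mem_coordSimplex h v

theorem join_mem_coordSimplex_iff : (join hF a b t).1 ∈ coordSimplex σ ↔ t = 0 := by
  constructor
  · intro h
    have := h.2.2
    rw [sum_join] at this
    ext
    simpa using this
  · rintro rfl
    rw [join_zero]
    exact a.2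

end Realization

/-! ### Cone neighbourhoods and the push away from one simplex -/

namespace Realization

variable {V : Type*} {F : Set (Finset V)} {σ : Finset V}

/-- The cone coordinate, along the segment from `a` to a point of the link, at which the cone
neighbourhood of the open simplex `σ` ends. It vanishes on the boundary of `σ`. -/
noncomputable def coneRadius (a : coordSimplex σ) : unitInterval :=
  ⟨(∏ v ∈ σ, a.1 v) / 3, by
    have h0 : 0 ≤ ∏ v ∈ σ, a.1 v := Finset.prod_nonneg fun v _ => a.2.1 v
    have h1 : ∏ v ∈ σ, a.1 v ≤ 1 :=
      Finset.prod_le_one (fun v _ => a.2.1 v) fun v _ => le_one_of_mem_coordSimplex a.2 v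
    constructor <;> linarith⟩

theorem continuous_coneRadius : Continuous (coneRadius (σ := σ)) := by
  refine Continuous.subtype_mk (Continuous.div_const (continuous_finsetProd _ fun v _ => ?_) _) _
  exact (continuous_apply v).comp continuous_subtype_val

theorem three_mul_coneRadius_le (a : coordSimplex σ) {v : V} (hv : v ∈ σ) :
    3 * (coneRadius a : ℝ) ≤ a.1 v := by
  classical
  have h1 : ∏ v ∈ σ.erase v, a.1 v ≤ 1 :=
    Finset.prod_le_one (fun v _ => a.2.1 v) fun v _ => le_one_of_mem_coordSimplex a.2 v
  have h2 := mul_le_mul_of_nonneg_left h1 (a.2.1 v)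
  rw [Finset.mul_prod_erase σ a.1 hv] at h2
  simp only [coneRadius]
  linarith

theorem three_mul_coneRadius_le_one (a : coordSimplex σ) : 3 * (coneRadius a : ℝ) ≤ 1 := by
  obtain ⟨v, hv⟩ := nonempty_of_mem_coordSimplex a.2
  exact (three_mul_coneRadius_le a hv).trans (le_one_of_mem_coordSimplex a.2 v)

/-- The point of the cone neighbourhood of `σ` over `a` in `σ` and `b` in the link with cone
coordinate `u`. -/
noncomputable def conePoint (hF : IsRelLowerSet F Finset.Nonempty) (a : coordSimplex σ)
    (b : Realization (linkFaces F σ)) (u : unitInterval) : Realization F :=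
  join hF a b (u * coneRadius a)

theorem mul_coneRadius_le (a : coordSimplex σ) (u : unitInterval) :
    ((u * coneRadius a : unitInterval) : ℝ) ≤ coneRadius a :=
  mul_le_of_le_one_left (coneRadius a).2.1 u.2.2

variable {hF : IsRelLowerSet F Finset.Nonempty}

theorem conePoint_apply_le (a : coordSimplex σ) (b : Realization (linkFaces F σ))
    (u : unitInterval) {v : V} (hv : v ∉ σ) : (conePoint hF a b u).1 v ≤ coneRadius a := by
  rw [conePoint, join_apply_of_notMem a b _ hv]
  refine le_trans ?_ (mul_coneRadius_le a u)
  exact mul_le_of_le_one_right (u * coneRadius a).2.1 (coord_le_one b v)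

/-- This is the reason for the divisor 3 in the radius `r`: on `σ` one has `a v ≥ 3 r`, and `1 - t ≥
1 - r ≥ 2 / 3`. -/
theorem le_conePoint_apply (a : coordSimplex σ) (b : Realization (linkFaces F σ))
    (u : unitInterval) {v : V} (hv : v ∈ σ) :
    2 * (coneRadius a : ℝ) ≤ (conePoint hF a b u).1 v := by
  rw [conePoint, join_apply_of_mem a b _ hv]
  have h1 := three_mul_coneRadius_le a hv
  have h2 := three_mul_coneRadius_le_one a
  have h3 := mul_coneRadius_le a u
  have h4 := a.2.1 v
  nlinarith

/-- A vertex in `σ` but not in `σ'` gives `2 r ≤ r'`, and a vertex in `σ'` but not in `σ` gives `2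
r' ≤ r`; equal cardinality guarantees that both vertices exist. -/
theorem coneRadius_eq_zero_of_conePoint_eq {σ' : Finset V} (hcard : σ.card = σ'.card)
    (hne : σ ≠ σ') {a : coordSimplex σ} {b : Realization (linkFaces F σ)} {u : unitInterval}
    {a' : coordSimplex σ'} {b' : Realization (linkFaces F σ')} {u' : unitInterval}
    (h : conePoint hF a b u = conePoint hF a' b' u') : coneRadius a = 0 ∧ coneRadius a' = 0 := by
  obtain ⟨v, hv, hv'⟩ : ∃ v ∈ σ, v ∉ σ' := by
    by_contra! hc
    exact hne (Finset.eq_of_subset_of_card_le hc hcard.ge)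
  obtain ⟨w, hw', hw⟩ : ∃ w ∈ σ', w ∉ σ := by
    by_contra! hc
    exact hne (Finset.eq_of_subset_of_card_le hc hcard.le).symm
  have h1 := conePoint_apply_le (hF := hF) a b u hw
  have h2 := le_conePoint_apply (hF := hF) a b u hv
  have h3 := conePoint_apply_le (hF := hF) a' b' u' hv'
  have h4 := le_conePoint_apply (hF := hF) a' b' u' hw'
  rw [h] at h1 h2
  have h5 := (coneRadius a).2.1
  have h6 := (coneRadius a').2.1
  constructor <;> ext <;> simp only [Set.Icc.coe_zero] <;> linarith

/-- The parameter of the contraction of the link at time `r` and cone coordinate `u`. -/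
noncomputable def contractionTime (u r : unitInterval) : unitInterval :=
  Set.projIcc 0 1 zero_le_one (2 * (r : ℝ)) * unitInterval.symm u

/-- The cone coordinate at time `r` of a point of original cone coordinate `u`. -/
noncomputable def pushedCoord (u r : unitInterval) : unitInterval :=
  unitInterval.symm
    (unitInterval.symm (Set.projIcc 0 1 zero_le_one (2 * (r : ℝ) - 1)) * unitInterval.symm u)

theorem continuous_contractionTime :
    Continuous fun p : unitInterval × unitInterval => contractionTime p.1 p.2 := by
  unfold contractionTime
  exact (continuous_projIcc.comp (by fun_prop)).mul
    (unitInterval.continuous_symm.comp continuous_fst)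

theorem continuous_pushedCoord :
    Continuous fun p : unitInterval × unitInterval => pushedCoord p.1 p.2 := by
  unfold pushedCoord
  exact unitInterval.continuous_symm.comp
    ((unitInterval.continuous_symm.comp (continuous_projIcc.comp (by fun_prop))).mul
      (unitInterval.continuous_symm.comp continuous_fst))

theorem contractionTime_zero_right (u : unitInterval) : contractionTime u 0 = 0 := by
  rw [contractionTime, Set.projIcc_of_le_left _ (by simp)]
  exact zero_mul _

theorem contractionTime_one_left (r : unitInterval) : contractionTime 1 r = 0 := by
  rw [contractionTime, unitInterval.symm_one, mul_zero]

theorem pushedCoord_zero_right (u : unitInterval) : pushedCoord u 0 = u := by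
  rw [pushedCoord, Set.projIcc_of_le_left _ (by simp)]
  change unitInterval.symm (unitInterval.symm 0 * unitInterval.symm u) = u
  simp

theorem pushedCoord_one_left (r : unitInterval) : pushedCoord 1 r = 1 := by
  simp [pushedCoord]

theorem pushedCoord_one_right (u : unitInterval) : pushedCoord u 1 = 1 := by
  rw [pushedCoord, Set.projIcc_of_right_le _ (by norm_num)]
  change unitInterval.symm (unitInterval.symm 1 * unitInterval.symm u) = 1
  simp

theorem eq_zero_of_pushedCoord_eq_zero {u r : unitInterval} (h : pushedCoord u r = 0) : u = 0 := by
  rw [pushedCoord, unitInterval.symm_eq_zero] at h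
  have h1 := congrArg Subtype.val h
  rw [Set.Icc.coe_mul] at h1
  have h2 := (unitInterval.symm (Set.projIcc 0 1 zero_le_one (2 * (r : ℝ) - 1))).2
  have h3 := u.2.1
  have h4 := u.2.2
  simp only [unitInterval.coe_symm_eq, Set.Icc.coe_one, Set.mem_Icc] at h1 h2
  ext
  simp only [Set.Icc.coe_zero]
  nlinarith

/-- Until time `1 / 2` the tip of the cone stays in place; from then on the link over the tip is
fully contracted. Either way the choice of the link point over the tip is irrelevant. -/
theorem pushedCoord_zero_left_eq_zero_or (r : unitInterval) :
    pushedCoord 0 r = 0 ∨ contractionTime 0 r = 1 := by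
  rcases le_total (r : ℝ) (1 / 2) with h | h
  · left
    rw [pushedCoord, Set.projIcc_of_le_left _ (by linarith)]
    change unitInterval.symm (unitInterval.symm 0 * unitInterval.symm 0) = 0
    simp
  · right
    rw [contractionTime, Set.projIcc_of_right_le _ (by linarith)]
    change 1 * unitInterval.symm 0 = 1
    simp

/-- The isotopy of the cone neighbourhood of `σ` into the complement of `σ`, first contracting the
link and then moving away from `σ`. -/
noncomputable def push (hF : IsRelLowerSet F Finset.Nonempty)
    (H : C(unitInterval × Realization (linkFaces F σ), Realization (linkFaces F σ)))
    (a : coordSimplex σ) (b : Realization (linkFaces F σ)) (u r : unitInterval) : Realization F :=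
  conePoint hF a (H (contractionTime u r, b)) (pushedCoord u r)

variable {H : C(unitInterval × Realization (linkFaces F σ), Realization (linkFaces F σ))}
  {a : coordSimplex σ} {b : Realization (linkFaces F σ)} {u r : unitInterval}

theorem conePoint_val_of_eq_zero (h : u * coneRadius a = 0) : (conePoint hF a b u).1 = a.1 := by
  rw [conePoint, h, join_zero]

theorem push_zero (h0 : ∀ x, H (0, x) = x) : push hF H a b u 0 = conePoint hF a b u := by
  rw [push, contractionTime_zero_right, pushedCoord_zero_right, h0]

/-- The outer edge of the cone is fixed, so the push agrees there with the identity outside. -/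
theorem push_one_left (h0 : ∀ x, H (0, x) = x) : push hF H a b 1 r = conePoint hF a b 1 := by
  rw [push, contractionTime_one_left, pushedCoord_one_left, h0]

theorem push_of_coneRadius_eq_zero (h : coneRadius a = 0) :
    push hF H a b u r = conePoint hF a b u := by
  apply Subtype.ext
  rw [push, conePoint_val_of_eq_zero (by rw [h, mul_zero]),
    conePoint_val_of_eq_zero (by rw [h, mul_zero])]

/-- The coordinates on `σ` add up to `1 - t`, which determines `t`. Since `t < 1`, division recovers
`a`; the coordinates off `σ` are `t b` and recover `b` unless `t = 0`. -/
theorem conePoint_inj {a' : coordSimplex σ} {b' : Realization (linkFaces F σ)} {u' : unitInterval}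
    (h : conePoint hF a b u = conePoint hF a' b' u') :
    a = a' ∧ u * coneRadius a = u' * coneRadius a' ∧ (u * coneRadius a ≠ 0 → b = b') := by
  have hv := fun v => congrFun (congrArg Subtype.val h) v
  have ht : u * coneRadius a = u' * coneRadius a' := by
    have := Finset.sum_congr (rfl : σ = σ) fun v _ => hv v
    rw [conePoint, sum_join, conePoint, sum_join] at this
    ext
    linarith
  have hlt : ((u * coneRadius a : unitInterval) : ℝ) < 1 := by
    have h2 := three_mul_coneRadius_le_one a
    have h3 := mul_coneRadius_le a u
    linarith
  refine ⟨?_, ht, fun hne => ?_⟩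
  · ext v
    by_cases hvs : v ∈ σ
    · have := hv v
      rw [conePoint, join_apply_of_mem _ _ _ hvs, conePoint, join_apply_of_mem _ _ _ hvs, ← ht]
        at this
      exact mul_left_cancel₀ (by linarith) this
    · rw [a.2.2.1 v hvs, a'.2.2.1 v hvs]
  · apply Subtype.ext
    ext v
    by_cases hvs : v ∈ σ
    · rw [coord_eq_zero_of_mem b hvs, coord_eq_zero_of_mem b' hvs]
    · have := hv v
      rw [conePoint, join_apply_of_notMem _ _ _ hvs, conePoint, join_apply_of_notMem _ _ _ hvs,
        ← ht] at this
      exact mul_left_cancel₀ (fun h => hne (Subtype.ext h)) this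

/-- Two ambiguities remain: where the radius vanishes the push is stationary, and at `u = 0` either
the point has not moved or `H` has already reached the constant `c`. -/
theorem push_congr {c : Realization (linkFaces F σ)} (h1 : ∀ x, H (1, x) = c)
    {a' : coordSimplex σ} {b' : Realization (linkFaces F σ)}
    {u' : unitInterval} (h : conePoint hF a b u = conePoint hF a' b' u') :
    push hF H a b u r = push hF H a' b' u' r := by
  by_cases hr : coneRadius a = 0
  · have hr' : coneRadius a' = 0 := by rw [← (conePoint_inj h).1, hr]
    rw [push_of_coneRadius_eq_zero hr, push_of_coneRadius_eq_zero hr', h]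
  obtain ⟨rfl, hu, hb⟩ := conePoint_inj h
  obtain rfl : u = u' := by
    ext
    have := congrArg Subtype.val hu
    rw [Set.Icc.coe_mul, Set.Icc.coe_mul] at this
    exact mul_right_cancel₀ (fun h => hr (Subtype.ext h)) this
  by_cases h0 : u = 0
  · subst h0
    rcases pushedCoord_zero_left_eq_zero_or r with hz | hz
    · apply Subtype.ext
      rw [push, push, conePoint_val_of_eq_zero (by rw [hz, zero_mul]),
        conePoint_val_of_eq_zero (by rw [hz, zero_mul])]
    · rw [push, push, hz, h1, h1]
  · rw [hb (mul_ne_zero h0 hr)]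

theorem continuous_conePoint (hF : IsRelLowerSet F Finset.Nonempty) (σ : Finset V) :
    Continuous fun p : Realization (linkFaces F σ) × (coordSimplex σ × unitInterval) =>
      conePoint hF p.2.1 p.1 p.2.2 := by
  have h := continuous_coneRadius (σ := σ)
  exact (continuous_join hF σ).comp
    (f := fun p : Realization (linkFaces F σ) × (coordSimplex σ × unitInterval) =>
      (p.1, (p.2.1, p.2.2 * coneRadius p.2.1))) (by fun_prop)

theorem continuous_push (hF : IsRelLowerSet F Finset.Nonempty)
    (H : C(unitInterval × Realization (linkFaces F σ), Realization (linkFaces F σ))) :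
    Continuous fun p : (coordSimplex σ × Realization (linkFaces F σ) × unitInterval) ×
      unitInterval => push hF H p.1.1 p.1.2.1 p.1.2.2 p.2 := by
  refine (continuous_conePoint hF σ).comp (f := fun p : (coordSimplex σ ×
    Realization (linkFaces F σ) × unitInterval) × unitInterval =>
      (H (contractionTime p.1.2.2 p.2, p.1.2.1), (p.1.1, pushedCoord p.1.2.2 p.2))) ?_
  have h1 : Continuous fun p : (coordSimplex σ × Realization (linkFaces F σ) × unitInterval) ×
      unitInterval => contractionTime p.1.2.2 p.2 :=
    continuous_contractionTime.comp (f := fun p : (coordSimplex σ ×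
      Realization (linkFaces F σ) × unitInterval) × unitInterval => (p.1.2.2, p.2)) (by fun_prop)
  have h2 : Continuous fun p : (coordSimplex σ × Realization (linkFaces F σ) × unitInterval) ×
      unitInterval => pushedCoord p.1.2.2 p.2 :=
    continuous_pushedCoord.comp (f := fun p : (coordSimplex σ ×
      Realization (linkFaces F σ) × unitInterval) × unitInterval => (p.1.2.2, p.2)) (by fun_prop)
  fun_prop

/-- A function which is nonpositive outside the interior of the cone neighbourhood of `σ`, and
positive inside. -/
def coneFunction (σ : Finset V) (w : V → ℝ) : ℝ :=
  ∏ v ∈ σ, w v - 3 * (1 - ∑ v ∈ σ, w v) * (∑ v ∈ σ, w v) ^ σ.card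

theorem continuous_coneFunction (σ : Finset V) : Continuous (coneFunction σ) := by
  unfold coneFunction
  fun_prop

/-- With `r` the radius and `t = u r`, the product over `σ` is `3 r (1 - t) ^ σ.card`, from which `3
t (1 - t) ^ σ.card` is subtracted. The condition `t < r` thus becomes a polynomial inequality, with
no division by the mass on `σ`. -/
theorem coneFunction_conePoint : coneFunction σ (conePoint hF a b u).1 =
    3 * (1 - (u * coneRadius a : unitInterval)) ^ σ.card * coneRadius a * (1 - u) := by
  rw [coneFunction, conePoint, sum_join,
    Finset.prod_congr rfl fun v hv => join_apply_of_mem a b (u * coneRadius a) hv,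
    Finset.prod_mul_distrib, Finset.prod_const]
  have : ∏ v ∈ σ, a.1 v = 3 * coneRadius a := by
    rw [coneRadius]
    ring
  rw [this, Set.Icc.coe_mul]
  ring

theorem push_of_coneFunction_nonpos (h0 : ∀ x, H (0, x) = x)
    (h : coneFunction σ (conePoint hF a b u).1 ≤ 0) : push hF H a b u r = conePoint hF a b u := by
  by_cases hr : coneRadius a = 0
  · exact push_of_coneRadius_eq_zero hr
  suffices hu : u = 1 by
    subst hu
    exact push_one_left h0
  rw [coneFunction_conePoint] at h
  have h2 := three_mul_coneRadius_le_one a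
  have h3 := mul_coneRadius_le a u
  have h4 : 0 < (coneRadius a : ℝ) := unitInterval.pos_iff_ne_zero.2 hr
  have h5 : 0 < 3 * (1 - ((u * coneRadius a : unitInterval) : ℝ)) ^ σ.card * coneRadius a := by
    have : 0 < 1 - ((u * coneRadius a : unitInterval) : ℝ) := by linarith
    positivity
  have h6 := u.2.2
  ext
  simp only [Set.Icc.coe_one]
  by_contra hne
  exact absurd h (not_le.2 (mul_pos h5 (sub_pos.2 (lt_of_le_of_ne h6 hne))))

end Realization

/-! ### Continuity of the simultaneous push -/

/-- A continuous map from a compact space to a Hausdorff space is closed, hence a quotient map onto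
its image, also after multiplying by `T`. -/
theorem ContinuousOn.of_comp_of_compactSpace {X Y Z T : Type*} [TopologicalSpace X]
    [TopologicalSpace Y] [TopologicalSpace Z] [TopologicalSpace T] [CompactSpace X] [T2Space Y]
    [CompactSpace T] [T2Space T] {q : X → Y} (hq : Continuous q) {f : Y × T → Z}
    (hf : Continuous fun p : X × T => f (q p.1, p.2)) :
    ContinuousOn f (Set.range q ×ˢ Set.univ) := by
  rw [continuousOn_iff_isClosed]
  intro C hC
  refine ⟨Prod.map q id '' ((fun p : X × T => f (q p.1, p.2)) ⁻¹' C), ?_, ?_⟩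
  · exact ((hC.preimage hf).isCompact.image (hq.prodMap continuous_id)).isClosed
  · ext ⟨y, t⟩
    simp only [Set.mem_inter_iff, Set.mem_preimage, Set.mem_prod, Set.mem_range, Set.mem_univ,
      and_true, Set.mem_image, Prod.exists, Prod.map_apply, id, Prod.mk.injEq]
    constructor
    · rintro ⟨h, x, rfl⟩
      exact ⟨⟨x, t, h, rfl, rfl⟩, x, rfl⟩
    · rintro ⟨⟨x, t', h, rfl, rfl⟩, -⟩
      exact ⟨h, x, rfl⟩

theorem coordSimplex_nonempty {V : Type*} {s : Finset V} (hs : s.Nonempty) :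
    (coordSimplex s).Nonempty := by
  classical
  obtain ⟨v, hv⟩ := hs
  refine ⟨Pi.single v 1, fun w => ?_, fun w hw => ?_, ?_⟩
  · by_cases h : w = v
    · subst h
      simp
    · simp [h]
  · rw [Pi.single_eq_of_ne]
    rintro rfl
    exact hw hv
  · simp [hv]

theorem div_indicator_mem_coordSimplex {V : Type*} {s : Finset V} {w : V → ℝ} (h0 : ∀ v, 0 ≤ w v)
    (hpos : 0 < ∑ v ∈ s, w v) :
    (fun v => (s : Set V).indicator w v / ∑ v ∈ s, w v) ∈ coordSimplex s := by
  refine ⟨fun v => div_nonneg (Set.indicator_nonneg (fun v _ => h0 v) v) hpos.le,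
    fun v hv => by simp [hv], ?_⟩
  rw [← Finset.sum_div, div_eq_one_iff_eq hpos.ne']
  exact Finset.sum_congr rfl fun v hv => by simp [hv]

namespace Realization

variable {V : Type*} {F : Set (Finset V)} {σ τ : Finset V}

theorem sdiff_mem_linkFaces [DecidableEq V] (hF : IsRelLowerSet F Finset.Nonempty) (hτ : τ ∈ F)
    (h : σ ⊂ τ) : τ \ σ ∈ linkFaces F σ :=
  ⟨(hF hτ).2 Finset.sdiff_subset (Finset.sdiff_nonempty.2 h.2), Finset.sdiff_disjoint,
    τ, hτ, h.1, Finset.sdiff_subset⟩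

theorem pos_of_coneFunction_pos {w : V → ℝ} (hw : w ∈ coordSimplex τ)
    (h : 0 < coneFunction σ w) : ∀ v ∈ σ, 0 < w v := by
  classical
  have h1 : ∑ v ∈ σ, w v ≤ 1 := by
    have h2 := sum_add_sum_sdiff_eq_one (s := σ) hw
    have h3 := Finset.sum_nonneg fun v (_ : v ∈ τ \ σ) => hw.1 v
    linarith
  have h2 : 0 ≤ ∑ v ∈ σ, w v := Finset.sum_nonneg fun v _ => hw.1 v
  have h3 : 0 < ∏ v ∈ σ, w v := by
    have : 0 ≤ 3 * (1 - ∑ v ∈ σ, w v) * (∑ v ∈ σ, w v) ^ σ.card := by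
      have := sub_nonneg.2 h1
      positivity
    unfold coneFunction at h
    linarith
  intro v hv
  exact lt_of_le_of_ne (hw.1 v) fun h0 => h3.ne' (Finset.prod_eq_zero hv h0.symm)

/-- Normalizing the parts of `w` on `σ` and on `τ \ σ` gives `a` and `b`; `u` is the mass off `σ`
divided by the radius, and positivity of `coneFunction` says that this is below one. If the mass off
`σ` is zero, any `b` serves, and one exists because `τ ≠ σ`. -/
theorem exists_conePoint_eq [DecidableEq V] (hF : IsRelLowerSet F Finset.Nonempty) (hτ : τ ∈ F)
    (hσ : σ.Nonempty) (hne : τ ≠ σ) {w : V → ℝ} (hw : w ∈ coordSimplex τ)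
    (h : 0 < coneFunction σ w) :
    ∃ (hs : σ ⊂ τ) (a : coordSimplex σ) (b : coordSimplex (τ \ σ)) (u : unitInterval),
      (conePoint hF a (incl (sdiff_mem_linkFaces hF hτ hs) b) u).1 = w := by
  have hpos := pos_of_coneFunction_pos hw h
  have hsub : σ ⊂ τ := (subset_of_mem_coordSimplex hw hpos).ssubset_of_ne hne.symm
  have hm : 0 < ∑ v ∈ σ, w v := Finset.sum_pos hpos hσ
  have hsum := sum_add_sum_sdiff_eq_one (s := σ) hw
  have hm' : 0 ≤ ∑ v ∈ τ \ σ, w v := Finset.sum_nonneg fun v _ => hw.1 v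
  let a : coordSimplex σ := ⟨_, div_indicator_mem_coordSimplex hw.1 hm⟩
  have ha : (coneRadius a : ℝ) = (∏ v ∈ σ, w v) / (∑ v ∈ σ, w v) ^ σ.card / 3 := by
    rw [← Finset.prod_const, ← Finset.prod_div_distrib]
    simp only [coneRadius, a]
    congr 1
    exact Finset.prod_congr rfl fun v hv => by simp [hv]
  have hlt : ∑ v ∈ τ \ σ, w v < coneRadius a := by
    rw [ha, div_div, lt_div_iff₀ (by positivity)]
    unfold coneFunction at h
    rw [← hsum] at h
    linarith
  have hr : 0 < (coneRadius a : ℝ) := hm'.trans_lt hlt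
  obtain ⟨b, hb⟩ : ∃ b : coordSimplex (τ \ σ), ∀ v ∉ σ, (∑ v ∈ τ \ σ, w v) * b.1 v = w v := by
    rcases hm'.eq_or_lt with h0 | h0
    · obtain ⟨b, hb⟩ := coordSimplex_nonempty (Finset.sdiff_nonempty.2 hsub.2)
      refine ⟨⟨b, hb⟩, fun v hv => ?_⟩
      rw [← h0, zero_mul]
      by_cases hvτ : v ∈ τ
      · exact ((Finset.sum_eq_zero_iff_of_nonneg fun v _ => hw.1 v).1 h0.symm v
          (Finset.mem_sdiff.2 ⟨hvτ, hv⟩)).symm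
      · exact (hw.2.1 v hvτ).symm
    · refine ⟨⟨_, div_indicator_mem_coordSimplex hw.1 h0⟩, fun v hv => ?_⟩
      rw [mul_div_cancel₀ _ h0.ne']
      by_cases hvτ : v ∈ τ
      · simp [hv, hvτ]
      · simp [hvτ, hw.2.1 v hvτ]
  refine ⟨hsub, a, b, ⟨(∑ v ∈ τ \ σ, w v) / coneRadius a, by positivity,
    (div_le_one hr).2 hlt.le⟩, ?_⟩
  have hu : ((⟨(∑ v ∈ τ \ σ, w v) / coneRadius a, by positivity, (div_le_one hr).2 hlt.le⟩ *
      coneRadius a : unitInterval) : ℝ) = ∑ v ∈ τ \ σ, w v := div_mul_cancel₀ _ hr.ne'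
  ext v
  by_cases hv : v ∈ σ
  · rw [conePoint, join_apply_of_mem _ _ _ hv, hu]
    have : 1 - ∑ v ∈ τ \ σ, w v = ∑ v ∈ σ, w v := by linarith
    rw [this]
    simp only [a]
    rw [mul_div_cancel₀ _ hm.ne']
    simp [hv]
  · rw [conePoint, join_apply_of_notMem _ _ _ hv, hu]
    exact hb v hv

section pushMap

variable (hF : IsRelLowerSet F Finset.Nonempty) (S : Set (Finset V))
  (H : ∀ σ, C(unitInterval × Realization (linkFaces F σ), Realization (linkFaces F σ)))

/-- The relation that `y` is the position at time `r` of the point `x` of the cone neighbourhood of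
some simplex of `S`. -/
def IsPushed (x : Realization F) (r : unitInterval) (y : Realization F) : Prop :=
  ∃ σ ∈ S, ∃ (a : coordSimplex σ) (b : Realization (linkFaces F σ)) (u : unitInterval),
    x = conePoint hF a b u ∧ y = push hF (H σ) a b u r

open scoped Classical in
/-- The simultaneous push in the cone neighbourhoods of all simplices of `S`. -/
noncomputable def pushMap (p : Realization F × unitInterval) : Realization F :=
  if h : ∃ y, IsPushed hF S H p.1 p.2 y then h.choose else p.1

variable {hF S H} {n : ℕ}

theorem IsPushed.unique (hS : ∀ σ ∈ S, σ.card = n)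
    (h1 : ∀ σ ∈ S, ∃ c, ∀ x, H σ (1, x) = c) {x y z : Realization F}
    {r : unitInterval} (hy : IsPushed hF S H x r y)
    (hz : IsPushed hF S H x r z) : y = z := by
  obtain ⟨σ, hσ, a, b, u, hx, rfl⟩ := hy
  obtain ⟨σ', hσ', a', b', u', hx', rfl⟩ := hz
  by_cases heq : σ = σ'
  · subst heq
    obtain ⟨c, hc⟩ := h1 σ hσ
    exact push_congr hc (hx.symm.trans hx')
  · obtain ⟨hr, hr'⟩ := coneRadius_eq_zero_of_conePoint_eq
      ((hS σ hσ).trans (hS σ' hσ').symm) heq (hx.symm.trans hx')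
    rw [push_of_coneRadius_eq_zero hr, push_of_coneRadius_eq_zero hr', ← hx, ← hx']

theorem pushMap_conePoint (hS : ∀ σ ∈ S, σ.card = n)
    (h1 : ∀ σ ∈ S, ∃ c, ∀ x, H σ (1, x) = c) (hσ : σ ∈ S) (a : coordSimplex σ)
    (b : Realization (linkFaces F σ)) (u r : unitInterval) : pushMap hF S H (conePoint hF a b u, r) = push hF (H σ) a b u r := by
  have hp : IsPushed hF S H (conePoint hF a b u) r (push hF (H σ) a b u r) :=
    ⟨σ, hσ, a, b, u, rfl, rfl⟩
  have h : ∃ y, IsPushed hF S H (conePoint hF a b u) r y := ⟨_, hp⟩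
  rw [pushMap, dif_pos h]
  exact IsPushed.unique hS h1 h.choose_spec hp

theorem pushMap_eq_or (x : Realization F) (r : unitInterval) :
    pushMap hF S H (x, r) = x ∨ IsPushed hF S H x r (pushMap hF S H (x, r)) := by
  by_cases h : ∃ y, IsPushed hF S H x r y
  · right
    rw [pushMap, dif_pos h]
    exact h.choose_spec
  · left
    rw [pushMap, dif_neg h]

theorem pushMap_zero (h0 : ∀ σ ∈ S, ∀ x, H σ (0, x) = x)
    (x : Realization F) : pushMap hF S H (x, 0) = x := by
  rcases pushMap_eq_or (hF := hF) (S := S) (H := H) x 0 with h | ⟨σ, hσ, a, b, u, hx, h⟩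
  · exact h
  · rw [h, push_zero (h0 σ hσ), ← hx]

theorem pushMap_of_coneFunction_nonpos (h0 : ∀ σ ∈ S, ∀ x, H σ (0, x) = x)
    {x : Realization F} (r : unitInterval)
    (h : ∀ σ ∈ S, coneFunction σ x.1 ≤ 0) : pushMap hF S H (x, r) = x := by
  rcases pushMap_eq_or (hF := hF) (S := S) (H := H) x r with h | ⟨σ, hσ, a, b, u, hx, h'⟩
  · exact h
  · rw [h', push_of_coneFunction_nonpos (h0 σ hσ) (by rw [← hx]; exact h σ hσ), ← hx]

/-- The simplex `τ` is covered by finitely many closed sets: the set where every `coneFunction` is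
nonpositive, on which nothing moves, and the compact cone pieces of the proper faces in `S`. On each
piece continuity descends from the cone parameters. -/
theorem continuous_pushMap_simplex (hSF : S ⊆ F) (hS : ∀ σ ∈ S, σ.card = n)
    (h0 : ∀ σ ∈ S, ∀ x, H σ (0, x) = x) (h1 : ∀ σ ∈ S, ∃ c, ∀ x, H σ (1, x) = c)
    (hτ : τ ∈ F) (hτS : τ ∉ S) :
    Continuous fun p : coordSimplex τ × unitInterval => pushMap hF S H (incl hτ p.1, p.2) := by
  classical
  let Z : Set (coordSimplex τ) := {w | ∀ σ ∈ S, coneFunction σ w.1 ≤ 0}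
  let ι := {σ : Finset V // σ ⊂ τ ∧ σ ∈ S}
  have : Finite ι :=
    Finite.of_injective (fun i : ι => (⟨i.1, Finset.mem_powerset.2 i.2.1.1⟩ : τ.powerset))
      fun i j h => Subtype.ext (congrArg (fun s : τ.powerset => s.1) h)
  let point (i : ι) (p : coordSimplex i.1 × coordSimplex (τ \ i.1) × unitInterval) :
      coordSimplex τ := ⟨(conePoint hF p.1 (incl (sdiff_mem_linkFaces hF hτ i.2.1) p.2.1) p.2.2).1,
        by
          have h := join_mem_coordSimplex p.1.2 p.2.1.2 (p.2.2 * coneRadius p.1)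
          rwa [Finset.union_sdiff_of_subset i.2.1.1] at h⟩
  have hpoint (i : ι) : Continuous (point i) := by
    have hc := continuous_coneRadius (σ := i.1)
    refine Continuous.subtype_mk (continuous_pi fun v => ?_) _
    simp only [conePoint, join, incl]
    have ha : Continuous fun p : coordSimplex i.1 × coordSimplex (τ \ i.1) × unitInterval =>
        p.1.1 v := (continuous_apply v).comp (continuous_subtype_val.comp continuous_fst)
    have hb : Continuous fun p : coordSimplex i.1 × coordSimplex (τ \ i.1) × unitInterval =>
        p.2.1.1 v :=
      (continuous_apply v).comp (continuous_subtype_val.comp (continuous_fst.comp continuous_snd))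
    fun_prop
  let C : Option ι → Set (coordSimplex τ × unitInterval)
    | none => Z ×ˢ Set.univ
    | some i => Set.range (point i) ×ˢ Set.univ
  refine (locallyFinite_of_finite C).continuous ?_ ?_ ?_
  · rw [Set.eq_univ_iff_forall]
    rintro ⟨w, r⟩
    rw [Set.mem_iUnion]
    by_cases hw : w ∈ Z
    · exact ⟨none, hw, trivial⟩
    · simp only [Z, Set.mem_ofPred_eq, not_forall, not_le] at hw
      obtain ⟨σ, hσ, hpos⟩ := hw
      obtain ⟨hs, a, b, u, h⟩ := exists_conePoint_eq hF hτ (hF (hSF hσ)).1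
        (by rintro rfl; exact hτS hσ) w.2 hpos
      exact ⟨some ⟨σ, hs, hσ⟩, ⟨(a, b, u), Subtype.ext h⟩, trivial⟩
  · rintro (_ | i)
    · refine IsClosed.prod ?_ isClosed_univ
      have : Z = ⋂ σ ∈ S, {w : coordSimplex τ | coneFunction σ w.1 ≤ 0} := by
        ext w
        simp [Z]
      rw [this]
      exact isClosed_biInter fun σ _ => isClosed_le
        ((continuous_coneFunction σ).comp continuous_subtype_val) continuous_const
    · exact (isCompact_range (hpoint i)).isClosed.prod isClosed_univ
  · rintro (_ | i)
    · refine ContinuousOn.congr (f := fun p => incl hτ p.1)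
        ((continuous_incl hτ).comp continuous_fst).continuousOn ?_
      rintro ⟨w, r⟩ ⟨hw, -⟩
      exact pushMap_of_coneFunction_nonpos h0 r hw
    · refine ContinuousOn.of_comp_of_compactSpace (hpoint i) ?_
      have heq (p : coordSimplex i.1 × coordSimplex (τ \ i.1) × unitInterval) :
          incl hτ (point i p) =
            conePoint hF p.1 (incl (sdiff_mem_linkFaces hF hτ i.2.1) p.2.1) p.2.2 := rfl
      simp only [heq, pushMap_conePoint hS h1 i.2.2]
      have hincl := continuous_incl (sdiff_mem_linkFaces hF hτ i.2.1)
      exact (continuous_push hF (H i.1)).comp (f := fun p : (coordSimplex i.1 ×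
        coordSimplex (τ \ i.1) × unitInterval) × unitInterval =>
          ((p.1.1, incl (sdiff_mem_linkFaces hF hτ i.2.1) p.1.2.1, p.1.2.2), p.2)) (by fun_prop)

theorem continuous_pushMap (hSF : S ⊆ F) (hS : ∀ σ ∈ S, σ.card = n)
    (h0 : ∀ σ ∈ S, ∀ x, H σ (0, x) = x) (h1 : ∀ σ ∈ S, ∃ c, ∀ x, H σ (1, x) = c) :
    Continuous (pushMap hF S H) := by
  classical
  refine continuous_prod_of_simplices fun τ hτ => ?_
  by_cases hτS : τ ∈ S
  -- A simplex of `S` is not covered by cones inside itself. The end point of the contraction shows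
  -- that its link is nonempty, so it lies in a larger simplex, which is outside `S` for having more
  -- vertices.
  · obtain ⟨⟨b, ρ, hρ, hb⟩, -⟩ := h1 τ hτS
    have hρne := nonempty_of_mem_coordSimplex hb
    have hunion := union_mem_of_mem_linkFaces hF hρ
    have hnot : τ ∪ ρ ∉ S := fun h => by
      have h2 := hS _ h
      rw [Finset.card_union_of_disjoint hρ.2.1.symm, hS _ hτS] at h2
      have h3 := hρne.card_pos
      omega
    have hsub : coordSimplex τ ⊆ coordSimplex (τ ∪ ρ) := coordSimplex_mono Finset.subset_union_left
    have hmono : Continuous fun p : coordSimplex τ × unitInterval =>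
        ((Set.inclusion hsub p.1, p.2) :
          coordSimplex (τ ∪ ρ) × unitInterval) :=
      ((continuous_inclusion hsub).comp continuous_fst).prodMk continuous_snd
    exact (continuous_pushMap_simplex hSF hS h0 h1 hunion hnot).comp hmono
  · exact continuous_pushMap_simplex hSF hS h0 h1 hτ hτS

end pushMap

end Realization

/-! ### Homotopy equivalences -/

section HomotopyEquivalence

theorem IsHomotopyEquivalence.comp {X Y Z : Type*} [TopologicalSpace X] [TopologicalSpace Y]
    [TopologicalSpace Z] {f' : C(Y, Z)} {f : C(X, Y)} (hf' : IsHomotopyEquivalence f')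
    (hf : IsHomotopyEquivalence f) : IsHomotopyEquivalence (f'.comp f) := by
  obtain ⟨g', h1', h2'⟩ := hf'
  obtain ⟨g, h1, h2⟩ := hf
  refine ⟨g.comp g', ?_, ?_⟩
  · exact (((ContinuousMap.Homotopic.refl g).comp
      (h1'.comp (ContinuousMap.Homotopic.refl f)))).trans h1
  · exact (((ContinuousMap.Homotopic.refl f').comp
      (h2.comp (ContinuousMap.Homotopic.refl g')))).trans h2'

theorem Homeomorph.isHomotopyEquivalence {X Y : Type*} [TopologicalSpace X] [TopologicalSpace Y]
    (e : X ≃ₜ Y) : IsHomotopyEquivalence (⟨e, e.continuous⟩ : C(X, Y)) := by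
  refine ⟨⟨e.symm, e.symm.continuous⟩, ?_, ?_⟩
  · convert ContinuousMap.Homotopic.refl (ContinuousMap.id X)
    ext x
    simp
  · convert ContinuousMap.Homotopic.refl (ContinuousMap.id Y)
    ext x
    simp

/-- A deformation of `B` into `A` which preserves `A` makes the inclusion a homotopy
equivalence. -/
theorem isHomotopyEquivalence_inclusion {X : Type*} [TopologicalSpace X] {A B : Set X}
    (hAB : A ⊆ B) {Φ : X × unitInterval → X} (hΦ : Continuous Φ) (h0 : ∀ x, Φ (x, 0) = x)
    (hB : ∀ x ∈ B, ∀ r, Φ (x, r) ∈ B) (hA : ∀ x ∈ A, ∀ r, Φ (x, r) ∈ A)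
    (h1 : ∀ x ∈ B, Φ (x, 1) ∈ A) :
    IsHomotopyEquivalence (⟨Set.inclusion hAB, continuous_inclusion hAB⟩ : C(A, B)) := by
  refine ⟨⟨fun x => ⟨Φ (x.1, 1), h1 x.1 x.2⟩, by fun_prop⟩, ?_, ?_⟩
  · refine ContinuousMap.Homotopic.symm ⟨⟨⟨fun p => ⟨Φ (p.2.1, p.1), hA p.2.1 p.2.2 p.1⟩,
      by fun_prop⟩, fun x => ?_, fun x => ?_⟩⟩
    · exact Subtype.ext (h0 x.1)
    · rfl
  · refine ContinuousMap.Homotopic.symm ⟨⟨⟨fun p => ⟨Φ (p.2.1, p.1), hB p.2.1 p.2.2 p.1⟩,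
      by fun_prop⟩, fun x => ?_, fun x => ?_⟩⟩
    · exact Subtype.ext (h0 x.1)
    · rfl

end HomotopyEquivalence

/-! ### Induction over the skeleta of the subcomplex -/

namespace Realization

variable {V : Type*} {F : Set (Finset V)} {σ : Finset V} {hF : IsRelLowerSet F Finset.Nonempty}
  {S : Set (Finset V)} {n : ℕ}
  {H : ∀ σ, C(unitInterval × Realization (linkFaces F σ), Realization (linkFaces F σ))}

theorem conePoint_mem_coordSimplex_iff {a : coordSimplex σ} {b : Realization (linkFaces F σ)}
    {u : unitInterval} (ha : coneRadius a ≠ 0) :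
    (conePoint hF a b u).1 ∈ coordSimplex σ ↔ u = 0 := by
  rw [conePoint, join_mem_coordSimplex_iff]
  exact mul_eq_zero_iff_right ha

/-- A point in a cone of nonzero radius stays in the open star of `σ`, hence off every closed
simplex not containing `σ`. The last clause treats `σ` itself: its cone coordinate never returns to
zero, and equals one at time one. -/
theorem pushMap_eq_or_exists (x : Realization F) (r : unitInterval) :
    pushMap hF S H (x, r) = x ∨ ∃ σ ∈ S, (∀ v ∈ σ, 0 < (pushMap hF S H (x, r)).1 v) ∧
      (r = 1 ∨ x.1 ∉ coordSimplex σ → (pushMap hF S H (x, r)).1 ∉ coordSimplex σ) := by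
  rcases pushMap_eq_or (hF := hF) (S := S) (H := H) x r with h | ⟨σ, hσ, a, b, u, hx, h⟩
  · exact Or.inl h
  by_cases hr : coneRadius a = 0
  · left
    rw [h, push_of_coneRadius_eq_zero hr, hx]
  · refine Or.inr ⟨σ, hσ, ?_, ?_⟩
    · intro v hv
      have h1 : 0 < (coneRadius a : ℝ) := unitInterval.pos_iff_ne_zero.2 hr
      have h2 := le_conePoint_apply (hF := hF) a (H σ (contractionTime u r, b))
        (pushedCoord u r) hv
      rw [h, push]
      linarith
    · rw [h, push, conePoint_mem_coordSimplex_iff hr, hx, conePoint_mem_coordSimplex_iff hr]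
      rintro (rfl | hu) h2
      · rw [pushedCoord_one_right] at h2
        exact one_ne_zero h2
      · exact hu (eq_zero_of_pushedCoord_eq_zero h2)

theorem pushMap_one_notMem (hS : ∀ σ ∈ S, σ.card = n)
    (h1 : ∀ σ ∈ S, ∃ c, ∀ x, H σ (1, x) = c) (hσ : σ ∈ S) {x : Realization F}
    (hx : x.1 ∈ coordSimplex σ) (hpos : ∀ v ∈ σ, 0 < x.1 v) :
    (pushMap hF S H (x, 1)).1 ∉ coordSimplex σ := by
  obtain ⟨c, -⟩ := h1 σ hσ
  have hr : coneRadius ⟨x.1, hx⟩ ≠ 0 := by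
    rw [← unitInterval.pos_iff_ne_zero]
    exact div_pos (Finset.prod_pos hpos) three_pos
  -- A point of the open simplex is a cone tip, so any link point represents it; `c` is at hand
  -- because the link is nonempty.
  have hxc : x = conePoint hF ⟨x.1, hx⟩ c 0 :=
    Subtype.ext (conePoint_val_of_eq_zero (a := ⟨x.1, hx⟩) (zero_mul _)).symm
  intro h
  rw [hxc, pushMap_conePoint hS h1 hσ, push, pushedCoord_one_right,
    conePoint_mem_coordSimplex_iff hr] at h
  exact one_ne_zero h

/-- The points outside the simplices of `G` with at most `n` vertices. -/
def skeletonCompl (F G : Set (Finset V)) (n : ℕ) : Set (Realization F) :=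
  {x | ∀ ρ ∈ G, ρ.card ≤ n → x.1 ∉ coordSimplex ρ}

theorem skeletonCompl_succ_subset (F G : Set (Finset V)) (n : ℕ) :
    skeletonCompl F G (n + 1) ⊆ skeletonCompl F G n :=
  fun _ hx ρ hρ hn => hx ρ hρ (hn.trans n.le_succ)

theorem skeletonCompl_zero {G : Set (Finset V)} (hF : IsRelLowerSet F Finset.Nonempty)
    (hGF : G ⊆ F) : skeletonCompl F G 0 = Set.univ := by
  refine Set.eq_univ_of_forall fun x ρ hρ h => ?_
  have := (hF (hGF hρ)).1.card_pos
  omega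

/-- A point of a closed simplex `ρ` of `G`, but of no simplex of `G` with fewer vertices, is in the
open simplex. -/
theorem pos_of_mem_skeletonCompl {G : Set (Finset V)} (hG : IsRelLowerSet G Finset.Nonempty)
    {x : Realization F} (hx : x ∈ skeletonCompl F G n) {ρ : Finset V} (hρ : ρ ∈ G)
    (hcard : ρ.card ≤ n + 1) (h : x.1 ∈ coordSimplex ρ) : ∀ v ∈ ρ, 0 < x.1 v := by
  classical
  intro v hv
  refine lt_of_le_of_ne (h.1 v) fun h0 => ?_
  have hmem : x.1 ∈ coordSimplex (ρ.erase v) := by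
    refine ⟨h.1, fun w hw => ?_, ?_⟩
    · by_cases hwv : w = v
      · rw [hwv, ← h0]
      · exact h.2.1 w fun hwρ => hw (Finset.mem_erase.2 ⟨hwv, hwρ⟩)
    · rw [← h.2.2]
      exact Finset.sum_erase ρ h0.symm
  refine hx _ ((hG hρ).2 (Finset.erase_subset v ρ) (nonempty_of_mem_coordSimplex hmem)) ?_ hmem
  rw [Finset.card_erase_of_mem hv]
  omega

theorem isHomotopyEquivalence_skeletonCompl_succ {G : Set (Finset V)}
    (hF : IsRelLowerSet F Finset.Nonempty) (hG : IsRelLowerSet G Finset.Nonempty) (hGF : G ⊆ F)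
    (hlink : ∀ σ ∈ G, ContractibleSpace (Realization (linkFaces F σ))) (n : ℕ) :
    IsHomotopyEquivalence (⟨Set.inclusion (skeletonCompl_succ_subset F G n),
      continuous_inclusion _⟩ : C(skeletonCompl F G (n + 1), skeletonCompl F G n)) := by
  let S : Set (Finset V) := {σ | σ ∈ G ∧ σ.card = n + 1}
  have hex : ∀ σ, ∃ H : C(unitInterval × Realization (linkFaces F σ), Realization (linkFaces F σ)),
      σ ∈ G → (∀ x, H (0, x) = x) ∧ ∃ c, ∀ x, H (1, x) = c := by
    intro σ
    by_cases hσ : σ ∈ G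
    · have := hlink σ hσ
      obtain ⟨c, ⟨H⟩⟩ := id_nullhomotopic (Realization (linkFaces F σ))
      exact ⟨H.toContinuousMap, fun _ => ⟨H.map_zero_left, c, H.map_one_left⟩⟩
    -- The stationary homotopy is a dummy value for simplices outside `G`.
    · exact ⟨ContinuousMap.snd, fun h => absurd h hσ⟩
  choose H hH using hex
  have hS : ∀ σ ∈ S, σ.card = n + 1 := fun σ hσ => hσ.2
  have h0 : ∀ σ ∈ S, ∀ x, H σ (0, x) = x := fun σ hσ => (hH σ hσ.1).1
  have h1 : ∀ σ ∈ S, ∃ c, ∀ x, H σ (1, x) = c := fun σ hσ => (hH σ hσ.1).2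
  have hkeep : ∀ x ∈ skeletonCompl F G n, ∀ r, pushMap hF S H (x, r) ∈ skeletonCompl F G n := by
    intro x hx r
    rcases pushMap_eq_or_exists (hF := hF) (S := S) (H := H) x r with h | ⟨σ, hσ, hpos, -⟩
    · rwa [h]
    · intro ρ hρ hn hmem
      have := Finset.card_le_card (subset_of_mem_coordSimplex hmem hpos)
      rw [hσ.2] at this
      omega
  have hsucc : ∀ x ∈ skeletonCompl F G n, ∀ r, (r = 1 ∨ x ∈ skeletonCompl F G (n + 1)) →
      pushMap hF S H (x, r) ∈ skeletonCompl F G (n + 1) := by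
    intro x hx r hr ρ hρ hn hmem
    have hρS : ρ ∈ S := ⟨hρ, by
      by_contra hne
      exact hkeep x hx r ρ hρ (by omega) hmem⟩
    rcases pushMap_eq_or_exists (hF := hF) (S := S) (H := H) x r with h | ⟨σ, hσ, hpos, h2⟩
    · rw [h] at hmem
      rcases hr with rfl | hr
      · refine pushMap_one_notMem (hF := hF) hS h1 hρS hmem
          (pos_of_mem_skeletonCompl hG hx hρ hn hmem) ?_
        rwa [h]
      · exact hr ρ hρ hn hmem
    -- Positivity on `σ` forces `σ ⊆ ρ`, and `ρ` has no more vertices than `σ`.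
    · obtain rfl : σ = ρ := Finset.eq_of_subset_of_card_le
        (subset_of_mem_coordSimplex hmem hpos) (by rw [hσ.2]; exact hn)
      exact h2 (hr.imp_right fun h => h σ hσ.1 hσ.2.le) hmem
  exact isHomotopyEquivalence_inclusion (skeletonCompl_succ_subset F G n)
    (continuous_pushMap (fun σ hσ => hGF hσ.1) hS h0 h1) (pushMap_zero h0) hkeep
    (fun x hx r => hsucc x (skeletonCompl_succ_subset F G n hx) r (Or.inr hx))
    (fun x hx => hsucc x hx 1 (Or.inl rfl))

theorem isHomotopyEquivalence_skeletonCompl {G : Set (Finset V)}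
    (hF : IsRelLowerSet F Finset.Nonempty) (hG : IsRelLowerSet G Finset.Nonempty) (hGF : G ⊆ F)
    (hlink : ∀ σ ∈ G, ContractibleSpace (Realization (linkFaces F σ))) (n : ℕ) :
    IsHomotopyEquivalence (⟨Subtype.val, continuous_subtype_val⟩ :
      C(skeletonCompl F G n, Realization F)) := by
  induction n with
  | zero =>
    exact ((Homeomorph.setCongr (skeletonCompl_zero hF hGF)).trans
      (Homeomorph.Set.univ _)).isHomotopyEquivalence
  | succ n ih => exact ih.comp (isHomotopyEquivalence_skeletonCompl_succ hF hG hGF hlink n)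

end Realization

/-! ### Comparison of the realization with the polyhedron -/

/-- The barycentric coordinates, extended by zero, are in `coordSimplex`. -/
theorem extend_mem_coordSimplex {V : Type*} {s : Finset V} (w : stdSimplex ℝ s) :
    Function.extend Subtype.val w.1 0 ∈ coordSimplex s := by
  have hv : ∀ v : s, Function.extend Subtype.val w.1 0 (v : V) = w.1 v :=
    fun v => Subtype.val_injective.extend_apply _ _ v
  have hn : ∀ v ∉ s, Function.extend (Subtype.val : s → V) w.1 0 v = 0 :=
    fun v hv => Function.extend_apply' _ _ _ (by rintro ⟨u, rfl⟩; exact hv u.2)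
  refine ⟨fun v => ?_, hn, ?_⟩
  · by_cases hs : v ∈ s
    · exact (hv ⟨v, hs⟩).symm ▸ w.2.1 ⟨v, hs⟩
    · rw [hn v hs]
  · rw [← w.2.2, ← Finset.sum_coe_sort]
    exact Finset.sum_congr rfl fun v _ => hv v

theorem restrict_mem_stdSimplex {V : Type*} {s : Finset V} (w : coordSimplex s) :
    (fun v : s => w.1 v) ∈ stdSimplex ℝ s :=
  ⟨fun v => w.2.1 v, by rw [Finset.sum_coe_sort s w.1]; exact w.2.2.2⟩

namespace Geometry.SimplicialComplex

variable {E : Type*} [AddCommGroup E] [Module ℝ E]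

variable (K : SimplicialComplex ℝ E)

theorem eq_of_sum_smul_eq_of_subset {s t : Finset E} (hs : s ∈ K.faces) (hts : t ⊆ s)
    {w w' : E → ℝ} (hw : w ∈ coordSimplex s) (hw' : w' ∈ coordSimplex t)
    (h : ∑ v ∈ s, w v • v = ∑ v ∈ t, w' v • v) : w = w' := by
  have hw's := coordSimplex_mono hts hw'
  have h' : ∑ v ∈ t, w' v • v = ∑ v ∈ s, w' v • v :=
    Finset.sum_subset hts fun v _ hv => by rw [hw'.2.1 v hv, zero_smul]
  have hind := affineIndependent_iff.1 (K.indep hs) Finset.univ (fun v => w v - w' v)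
    (by rw [Finset.univ_eq_attach, Finset.sum_attach s fun v => w v - w' v,
          Finset.sum_sub_distrib, hw.2.2, hw's.2.2, sub_self])
    (by rw [Finset.univ_eq_attach, Finset.sum_attach s fun v => (w v - w' v) • v]
        simp_rw [sub_smul]
        rw [Finset.sum_sub_distrib, h, h', sub_self])
  ext v
  by_cases hv : v ∈ s
  · exact sub_eq_zero.1 (hind ⟨v, hv⟩ (Finset.mem_univ _))
  · rw [hw.2.1 v hv, hw's.2.1 v hv]

theorem exists_coordSimplex_of_mem_convexHull {s : Finset E} {x : E}
    (hx : x ∈ convexHull ℝ (s : Set E)) : ∃ w ∈ coordSimplex s, ∑ v ∈ s, w v • v = x := by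
  obtain ⟨w, h0, h1, h2⟩ := Finset.mem_convexHull'.1 hx
  refine ⟨(s : Set E).indicator w, ⟨fun v => ?_, fun v hv => by simp [hv], ?_⟩, ?_⟩
  · exact Set.indicator_nonneg h0 v
  · rw [← h1]
    exact Finset.sum_congr rfl fun v hv => by simp [hv]
  · rw [← h2]
    exact Finset.sum_congr rfl fun v hv => by simp [hv]

theorem sum_smul_mem_convexHull {s : Finset E} {w : E → ℝ} (hw : w ∈ coordSimplex s) :
    ∑ v ∈ s, w v • v ∈ convexHull ℝ (s : Set E) :=
  (convex_convexHull ℝ (s : Set E)).sum_mem (fun v _ => hw.1 v) hw.2.2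
    fun _ hv => subset_convexHull ℝ _ hv

/-- The common point lies in the hull of `s ∩ t`. Coordinates for it there agree with `w` by affine
independence of `s`, and with `w'` by that of `t`. -/
theorem eq_of_sum_smul_eq {s t : Finset E} (hs : s ∈ K.faces) (ht : t ∈ K.faces)
    {w w' : E → ℝ} (hw : w ∈ coordSimplex s) (hw' : w' ∈ coordSimplex t)
    (h : ∑ v ∈ s, w v • v = ∑ v ∈ t, w' v • v) : w = w' := by
  classical
  have hx := K.inter_subset_convexHull hs ht
    ⟨sum_smul_mem_convexHull hw, h ▸ sum_smul_mem_convexHull hw'⟩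
  rw [← Finset.coe_inter] at hx
  obtain ⟨z, hz, hzx⟩ := exists_coordSimplex_of_mem_convexHull hx
  rw [K.eq_of_sum_smul_eq_of_subset hs Finset.inter_subset_left hw hz hzx.symm,
    K.eq_of_sum_smul_eq_of_subset ht Finset.inter_subset_right hw' hz (h ▸ hzx.symm)]

theorem finsum_smul_eq {s : Finset E} {w : E → ℝ} (hw : w ∈ coordSimplex s) :
    ∑ᶠ v, w v • v = ∑ v ∈ s, w v • v := by
  refine finsum_eq_sum_of_support_subset _ fun v hv => ?_
  by_contra hvs
  exact hv (by simp only [hw.2.1 v hvs, zero_smul])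

/-- The point with given barycentric coordinates. -/
noncomputable def ofRealization (w : Realization K.faces) : K.Polyhedron :=
  ⟨∑ᶠ v, w.1 v • v, by
    obtain ⟨s, hs, hw⟩ := w.2
    rw [finsum_smul_eq hw]
    exact convexHull_subset_space hs (sum_smul_mem_convexHull hw)⟩

theorem ofRealization_incl {s : Finset E} (hs : s ∈ K.faces) (w : coordSimplex s) :
    K.ofRealization (Realization.incl hs w) =
      K.simplexMap ⟨s, hs⟩ ⟨_, restrict_mem_stdSimplex w⟩ := by
  refine Subtype.ext ((finsum_smul_eq w.2).trans ?_)
  exact (Finset.sum_coe_sort s fun v => w.1 v • v).symm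

theorem ofRealization_extend (s : K.faces) (w : stdSimplex ℝ (s : Finset E)) :
    K.ofRealization (Realization.incl s.2 ⟨_, extend_mem_coordSimplex w⟩) =
      K.simplexMap s w := by
  rw [ofRealization_incl]
  congr
  ext v
  exact Subtype.val_injective.extend_apply _ _ v

theorem ofRealization_bijective : Function.Bijective K.ofRealization := by
  constructor
  · rintro ⟨w, s, hs, hw⟩ ⟨w', t, ht, hw'⟩ h
    have h := congrArg Subtype.val h
    simp only [ofRealization] at h
    rw [finsum_smul_eq hw, finsum_smul_eq hw'] at h
    exact Subtype.ext (K.eq_of_sum_smul_eq hs ht hw hw' h)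
  · rintro ⟨x, hx⟩
    obtain ⟨s, hs, hxs⟩ := mem_space_iff.1 hx
    obtain ⟨w, hw, rfl⟩ := exists_coordSimplex_of_mem_convexHull hxs
    exact ⟨⟨w, s, hs, hw⟩, Subtype.ext (finsum_smul_eq hw)⟩

theorem continuous_simplexMap (s : K.faces) : Continuous (K.simplexMap s) :=
  continuous_iff_coinduced_le.2 <|
    le_iSup (fun s : K.faces => TopologicalSpace.coinduced (K.simplexMap s) inferInstance) s

/-- Barycentric coordinates identify the realization of the family of faces with the underlying
space. -/
noncomputable def realizationHomeomorph : Realization K.faces ≃ₜ K.Polyhedron where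
  toEquiv := Equiv.ofBijective K.ofRealization K.ofRealization_bijective
  continuous_toFun := by
    refine Realization.continuous_of_simplices fun s hs => ?_
    simp only [Equiv.ofBijective, ofRealization_incl]
    refine (K.continuous_simplexMap ⟨s, hs⟩).comp (Continuous.subtype_mk ?_ _)
    exact continuous_pi fun v => (continuous_apply _).comp continuous_subtype_val
  continuous_invFun := by
    refine continuous_iSup_dom.2 fun s => continuous_coinduced_dom.2 ?_
    have heq : (Equiv.ofBijective K.ofRealization K.ofRealization_bijective).symm ∘
        K.simplexMap s = fun w => Realization.incl s.2 ⟨_, extend_mem_coordSimplex w⟩ := by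
      ext1 w
      rw [Function.comp_apply, Equiv.symm_apply_eq]
      exact (K.ofRealization_extend s w).symm
    refine (continuous_congr (congrFun heq)).2
      ((Realization.continuous_incl s.2).comp (Continuous.subtype_mk (continuous_pi fun v => ?_) _))
    by_cases hv : v ∈ (s : Finset E)
    · have (w : stdSimplex ℝ (s : Finset E)) :
          Function.extend Subtype.val w.1 0 v = w.1 ⟨v, hv⟩ :=
        Subtype.val_injective.extend_apply _ _ (⟨v, hv⟩ : (s : Finset E))
      simp only [this]
      exact (continuous_apply _).comp continuous_subtype_val
    · have (w : stdSimplex ℝ (s : Finset E)) :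
          Function.extend Subtype.val w.1 0 v = (0 : ℝ) :=
        Function.extend_apply' _ _ _ (by rintro ⟨u, rfl⟩; exact hv u.2)
      simp only [this]
      exact continuous_const

theorem ofRealization_mem_space_iff {K L : SimplicialComplex ℝ E} (h : K ≤ L)
    (w : Realization L.faces) :
    (L.ofRealization w).val ∈ K.space ↔ ∃ s ∈ K.faces, w.1 ∈ coordSimplex s := by
  obtain ⟨w, t, ht, hw⟩ := w
  rw [mem_space_iff]
  refine exists_congr fun s => and_congr_right fun hs => ?_
  change ∑ᶠ v, w v • v ∈ _ ↔ _
  constructor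
  · intro hx
    rw [finsum_smul_eq hw] at hx
    obtain ⟨z, hz, hzx⟩ := exists_coordSimplex_of_mem_convexHull hx
    obtain rfl := L.eq_of_sum_smul_eq ht (h hs) hw hz hzx.symm
    exact hz
  · intro hx
    rw [finsum_smul_eq hx]
    exact sum_smul_mem_convexHull hx

end Geometry.SimplicialComplex

theorem mainTheorem4 {E : Type*} [AddCommGroup E] [Module ℝ E]
    (L L₀ : Geometry.SimplicialComplex ℝ E) (hL₀ : L₀ ≤ L) (hL : L.IsFiniteDimensional)
    (hlink : ∀ σ ∈ L₀.faces, ContractibleSpace (L.link σ).Polyhedron) :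
    IsHomotopyEquivalence
      (⟨Subtype.val, continuous_subtype_val⟩ :
        C({x : L.Polyhedron // x.val ∉ L₀.space}, L.Polyhedron)) := by
  obtain ⟨n, hn⟩ := hL
  have hlink' : ∀ σ ∈ L₀.faces,
      ContractibleSpace (Realization (Realization.linkFaces L.faces σ)) := by
    intro σ hσ
    have := hlink σ hσ
    exact (L.link σ).realizationHomeomorph.contractibleSpace
  -- Dimension at most `n` means at most `n + 1` vertices, so at this stage every simplex of `L₀`
  -- has been removed.
  have hmem (w : Realization L.faces) : w ∈ Realization.skeletonCompl L.faces L₀.faces (n + 1) ↔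
      (L.realizationHomeomorph w).val ∉ L₀.space := by
    refine Iff.trans ?_ (Geometry.SimplicialComplex.ofRealization_mem_space_iff hL₀ w).not.symm
    push Not
    exact forall₂_congr fun s hs => ⟨fun h => h (hn s (hL₀ hs)), fun h _ => h⟩
  have h := L.realizationHomeomorph.isHomotopyEquivalence.comp
    ((Realization.isHomotopyEquivalence_skeletonCompl L.isRelLowerSet_faces
      L₀.isRelLowerSet_faces hL₀ hlink' (n + 1)).comp
      (L.realizationHomeomorph.subtype
        (q := fun x : L.Polyhedron => x.val ∉ L₀.space) hmem).symm.isHomotopyEquivalence)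
  convert h using 1
  ext x
  exact (L.realizationHomeomorph.apply_symm_apply x.1).symm
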